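/- All groups are finite. A subgroup $A$ of a group $G$ is *quasinormal* in $G$ if $AX=XA$ for every subgroup $X$ of $G$; $G$ is a *$PT$-group* if quasinormality is transitive on $G$, that is, whenever $H\le K\le G$, $H$ is quasinormal in $K$ and $K$ is quasinormal in $G$, then $H$ is quasinormal in $G$. A subgroup $M$ of $G$ is *modular* in $G$ if (i) $\langle X, M\cap Z\rangle=\langle X,M\rangle\cap Z$ for all subgroups $X\le Z$ of $G$, and (ii) $\langle M, Y\cap Z\rangle=\langle M,Y\rangle\cap Z$ for all subgroups $Y,Z$ of $G$ with $M\le Z$. A subgroup $A$ of $G$ is *submodular* in $G$ if there is a chain of subgroups $A=A_0\le A_1\le\cdots\le A_n=G$ such that $A_{i-1}$ is modular in $A_i$ for all $i=1,\dots,n$. Finally, $G$ is an *$M$-group* if the lattice of all subgroups of $G$ is modular. **Proposition 4.13.** Let $G$ be a (finite) soluble $PT$-group. 1. Let $p$ be a prime. If every submodular $p$-subgroup of $G$ is modular in $G$, then every $p$-subgroup of $G$ is modular in $G$. 2. In particular, if every submodular subgroup of $G$ is modular in $G$, then $G$ is an $M$-group. -/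

import Mathlib

open scoped Pointwise

/-- `A` is quasinormal (permutable) in `G`: `AX = XA` for every subgroup `X` of `G`. -/
def IsQuasinormalSubgroup {G : Type*} [Group G] (A : Subgroup G) : Prop :=
  ∀ X : Subgroup G, (A : Set G) * (X : Set G) = (X : Set G) * (A : Set G)

/-- `G` is a `PT`-group: quasinormality is a transitive relation on `G`. For `H ≤ K`, the
subgroup `H.subgroupOf K` is `H` regarded as a subgroup of the group `K`. -/
def IsPTGroup (G : Type*) [Group G] : Prop :=
  ∀ H K : Subgroup G, H ≤ K → IsQuasinormalSubgroup (H.subgroupOf K) →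
    IsQuasinormalSubgroup K → IsQuasinormalSubgroup H

/-- `M` is modular in `G`: it is a modular element, in the sense of Kurosh, of the lattice of all
subgroups of `G`. -/
def IsModularSubgroup {G : Type*} [Group G] (M : Subgroup G) : Prop :=
  (∀ X Z : Subgroup G, X ≤ Z → X ⊔ (M ⊓ Z) = (X ⊔ M) ⊓ Z) ∧
  (∀ Y Z : Subgroup G, M ≤ Z → M ⊔ (Y ⊓ Z) = (M ⊔ Y) ⊓ Z)

/-- `A` is submodular in `G`: there is a chain `A = C 0 ≤ C 1 ≤ ⋯ ≤ C n = G` of subgroups in which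
each member is a modular subgroup of the next one. -/
def IsSubmodularSubgroup {G : Type*} [Group G] (A : Subgroup G) : Prop :=
  ∃ (n : ℕ) (C : ℕ → Subgroup G), C 0 = A ∧ C n = ⊤ ∧
    ∀ i < n, C i ≤ C (i + 1) ∧ IsModularSubgroup ((C i).subgroupOf (C (i + 1)))

/-- `G` is an `M`-group: the lattice of all subgroups of `G` is modular. -/
def IsMGroup (G : Type*) [Group G] : Prop :=
  IsModularLattice (Subgroup G)

/-!
By Zacher's theorem the nilpotent residual `D` of a soluble `PT`-group `G` is a Hall subgroup all
of whose subgroups are normal in `G`: the Sylow `q`-subgroup `Q` for the largest prime `q` is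
normal, elements of order prime to `q` induce power automorphisms on it, and one inducts on
`G / Q`, where `Q` either lies in `D` or has a normal complement containing `D`. In particular
`G / C(D)` is abelian.

Let `U` be a `p`-subgroup. If `p` divides `|D|`, then `U ≤ D` is normal. Otherwise let `Γ = C(D)`.
If `U Γ / Γ` has order dividing `p`, then `U` is submodular: for `K < L` with `L / K` of prime
order in a chain of subgroups of `D`, the normal subgroup `(U ∩ Γ) K` of `U L` has index dividing a
product of two primes, and `U K` lies between them. So it suffices to show `U ≤ Γ ⟨x⟩` for some
`x ∈ U` with `x ^ p ∈ Γ`.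

Take `x ∈ U \ Γ` with `x ^ p ∈ Γ`; then `V = (U ∩ Γ) ⟨x⟩` is submodular, hence modular. Choose a
`q`-element `g ∈ D` not commuting with `x`, and let `y ∈ U` not commute with `g`. As `g` is a power
of the commutator of `x` and `g y g⁻¹` modulo `[x, y] ∈ U ∩ Γ`, the join of `V` and `⟨g y g⁻¹⟩`
contains `y`, while `⟨g y g⁻¹⟩` meets `U` inside `⟨y ^ p⟩`. Modularity of `V` therefore forces
`y ∈ Γ ⟨x⟩ ⟨y ^ p⟩`, and so `y ∈ Γ ⟨x⟩`.
-/

open scoped commutatorElement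

section

variable {G : Type*} [Group G]

theorem eq_one_of_pow_eq_one_of_coprime {x : G} {m n : ℕ} (hm : x ^ m = 1) (hn : x ^ n = 1)
    (h : m.Coprime n) : x = 1 :=
  orderOf_eq_one_iff.1 (Nat.eq_one_of_dvd_coprimes h (orderOf_dvd_of_pow_eq_one hm)
    (orderOf_dvd_of_pow_eq_one hn))

theorem mem_of_pow_eq_one_of_coprime_index {N : Subgroup G} [N.Normal] {x : G} {m : ℕ}
    (hx : x ^ m = 1) (h : m.Coprime N.index) : x ∈ N := by
  rw [← QuotientGroup.eq_one_iff]
  refine eq_one_of_pow_eq_one_of_coprime (m := m) (n := N.index) ?_ ?_ h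
  · rw [← QuotientGroup.mk_pow, hx, QuotientGroup.mk_one]
  · rw [Subgroup.index_eq_card, pow_card_eq_one']

theorem exists_pow_prime_pow_eq_one {p : ℕ} {U : Subgroup G} (hU : IsPGroup p U) {u : G}
    (hu : u ∈ U) : ∃ k, u ^ p ^ k = 1 := by
  simpa [Subtype.ext_iff] using hU ⟨u, hu⟩

theorem mem_zpowers_zpow_of_not_dvd {d : G} {q k : ℕ} {s : ℤ} (hq : q.Prime)
    (hd : d ^ q ^ k = 1) (hs : ¬ (q : ℤ) ∣ s) : d ∈ Subgroup.zpowers (d ^ s) := by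
  rw [mem_zpowers_zpow_iff, ← Int.isCoprime_iff_gcd_eq_one]
  have hsq : IsCoprime s q := ((Nat.prime_iff_prime_int.1 hq).coprime_iff_not_dvd.2 hs).symm
  exact (hsq.pow_right (n := k)).of_isCoprime_of_dvd_right
    (by exact_mod_cast orderOf_dvd_of_pow_eq_one hd)

theorem dvd_of_zpow_eq_one {d : G} {q k : ℕ} {s : ℤ} (hq : q.Prime) (hd : d ^ q ^ k = 1)
    (hd1 : d ≠ 1) (hs : d ^ s = 1) : (q : ℤ) ∣ s := by
  by_contra hqs
  exact hd1 (by simpa [hs] using mem_zpowers_zpow_of_not_dvd hq hd hqs)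

theorem exists_pow_notMem_pow_mem {H : Subgroup G} {u : G} {p k : ℕ} (hu : u ∉ H)
    (hk : u ^ p ^ k ∈ H) : ∃ m, u ^ m ∉ H ∧ (u ^ m) ^ p ∈ H := by
  induction k with
  | zero => exact absurd (by simpa using hk) hu
  | succ k ih =>
    by_cases h : u ^ p ^ k ∈ H
    · exact ih h
    · exact ⟨p ^ k, h, by rwa [← pow_mul, ← pow_succ]⟩

theorem le_of_forall_primePow_mem [Finite G] {H K : Subgroup G}
    (h : ∀ x ∈ K, ∀ q : ℕ, q.Prime → ∀ k, x ^ q ^ k = 1 → x ∈ H) : K ≤ H := by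
  rw [← Subgroup.relIndex_eq_one, Nat.eq_one_iff_not_exists_prime_dvd]
  intro q hq hdvd
  have := Fact.mk hq
  let P : Sylow q K := default
  have hPH : (P : Subgroup K) ≤ H.subgroupOf K := fun x hx ↦ by
    obtain ⟨k, hk⟩ := exists_pow_prime_pow_eq_one P.isPGroup' hx
    exact h x x.2 q hq k (by exact_mod_cast congrArg Subtype.val hk)
  exact P.not_dvd_index (hdvd.trans (Subgroup.index_dvd_of_le hPH))

theorem pow_conj_of_conj_eq {x d : G} {r : ℤ} (h : x * d * x⁻¹ = d ^ r) (n : ℕ) :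
    x ^ n * d * (x ^ n)⁻¹ = d ^ r ^ n := by
  induction n with
  | zero => simp
  | succ n ih =>
    calc x ^ (n + 1) * d * (x ^ (n + 1))⁻¹ = x * (x ^ n * d * (x ^ n)⁻¹) * x⁻¹ := by
          rw [pow_succ']; group
      _ = d ^ r ^ (n + 1) := by rw [ih, ← conj_zpow, h, ← zpow_mul, pow_succ']

theorem zpow_eq_self_iff_orderOf_dvd {d : G} {r : ℤ} : d ^ r = d ↔ (orderOf d : ℤ) ∣ r - 1 := by
  rw [orderOf_dvd_iff_zpow_eq_one, zpow_sub_one, mul_inv_eq_one]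

theorem commute_of_coprime_totient {x d : G} (h : x * d * x⁻¹ ∈ Subgroup.zpowers d)
    (hx : IsOfFinOrder x) (hxd : (orderOf x).Coprime (orderOf d).totient) : Commute x d := by
  obtain ⟨r, hr⟩ := Subgroup.mem_zpowers_iff.1 h
  have hrn : (r : ZMod (orderOf d)) ^ orderOf x = 1 := by
    have hd := pow_conj_of_conj_eq hr.symm (orderOf x)
    rw [pow_orderOf_eq_one, one_mul, inv_one, mul_one, eq_comm, zpow_eq_self_iff_orderOf_dvd,
      ← ZMod.intCast_zmod_eq_zero_iff_dvd] at hd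
    simpa [sub_eq_zero] using hd
  have hu : IsUnit (r : ZMod (orderOf d)) := IsUnit.of_pow_eq_one hrn hx.orderOf_pos.ne'
  have hr1 : hu.unit = 1 := eq_one_of_pow_eq_one_of_coprime
    (Units.ext (by simpa using hrn)) (ZMod.pow_totient _) hxd
  have hd : d ^ r = d := by
    rw [zpow_eq_self_iff_orderOf_dvd, ← ZMod.intCast_zmod_eq_zero_iff_dvd, Int.cast_sub,
      sub_eq_zero]
    simpa using congrArg Units.val hr1
  exact mul_inv_eq_iff_eq_mul.1 (hr.symm.trans hd)

theorem not_dvd_sub_one_of_not_commute {x d : G} {r : ℤ} {q k : ℕ}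
    (hx : (orderOf x).Coprime q) (hd : d ^ q ^ k = 1) (h : x * d * x⁻¹ = d ^ r)
    (hxd : ¬ Commute x d) : ¬ (q : ℤ) ∣ r - 1 := by
  refine fun hqr ↦ hxd ?_
  have hdvd : (orderOf d : ℤ) ∣ r ^ q ^ k - 1 := by
    have hpow := dvd_sub_pow_of_dvd_sub hqr k
    rw [one_pow] at hpow
    refine .trans ?_ ((pow_dvd_pow _ k.le_succ).trans hpow)
    exact_mod_cast orderOf_dvd_of_pow_eq_one hd
  have hcomm : Commute (x ^ q ^ k) d := mul_inv_eq_iff_eq_mul.1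
    ((pow_conj_of_conj_eq h _).trans (zpow_eq_self_iff_orderOf_dvd.2 hdvd))
  obtain ⟨m, hm⟩ := exists_pow_eq_self_of_coprime (hx.pow_right k).symm
  exact hm ▸ hcomm.pow_left m

/-- The subgroup of the elements of `G` that induce power automorphisms on `Q`, that is, that
normalise every subgroup of `Q`; for `Q = ⊤` it is the Baer norm of `G`. -/
def powerNormalizer (Q : Subgroup G) : Subgroup G :=
  ⨅ H ≤ Q, Subgroup.normalizer (H : Set G)

theorem conj_mem_of_mem_powerNormalizer {Q H : Subgroup G} {x a : G} (hx : x ∈ powerNormalizer Q)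
    (hH : H ≤ Q) (ha : a ∈ H) : x * a * x⁻¹ ∈ H := by
  simp only [powerNormalizer, Subgroup.mem_iInf] at hx
  exact (Subgroup.mem_normalizer_iff.1 (hx H hH) a).1 ha

theorem conj_mem_zpowers_of_mem_powerNormalizer {Q : Subgroup G} {x d : G}
    (hx : x ∈ powerNormalizer Q) (hd : d ∈ Q) : x * d * x⁻¹ ∈ Subgroup.zpowers d :=
  conj_mem_of_mem_powerNormalizer hx (Subgroup.zpowers_le.2 hd) (Subgroup.mem_zpowers d)

theorem mem_powerNormalizer_of_forall_conj_mem [Finite G] {Q : Subgroup G} {x : G}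
    (h : ∀ H ≤ Q, ∀ a ∈ H, x * a * x⁻¹ ∈ H) : x ∈ powerNormalizer Q := by
  simp only [powerNormalizer, Subgroup.mem_iInf]
  exact fun H hH ↦ Subgroup.mem_normalizer_fintype (h H hH)

theorem powerNormalizer_eq_top_iff {Q : Subgroup G} :
    powerNormalizer Q = ⊤ ↔ ∀ H ≤ Q, H.Normal := by
  simp only [powerNormalizer, iInf_eq_top, Subgroup.normalizer_eq_top_iff]

theorem mem_powerNormalizer_iff [Finite G] {Q : Subgroup G} {x : G} :
    x ∈ powerNormalizer Q ↔ ∀ d ∈ Q, x * d * x⁻¹ ∈ Subgroup.zpowers d :=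
  ⟨fun hx _ hd ↦ conj_mem_zpowers_of_mem_powerNormalizer hx hd,
    fun h ↦ mem_powerNormalizer_of_forall_conj_mem fun _ hH a ha ↦
      Subgroup.zpowers_le.2 ha (h a (hH ha))⟩

instance powerNormalizer_normal [Finite G] {Q : Subgroup G} [hQ : Q.Normal] :
    (powerNormalizer Q).Normal where
  conj_mem x hx g := mem_powerNormalizer_iff.2 fun d hd ↦ by
    obtain ⟨i, hi⟩ := Subgroup.mem_zpowers_iff.1
      (conj_mem_zpowers_of_mem_powerNormalizer hx (hQ.conj_mem' d hd g))
    refine Subgroup.mem_zpowers_iff.2 ⟨i, ?_⟩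
    calc d ^ i = g * (g⁻¹ * d * g) ^ i * g⁻¹ := by
          rw [← conj_zpow]; congr 1; group
      _ = g * x * g⁻¹ * d * (g * x * g⁻¹)⁻¹ := by rw [hi]; group

theorem commutator_le_centralizer_of_powerNormalizer_eq_top {Q : Subgroup G}
    (hQ : powerNormalizer Q = ⊤) : commutator G ≤ Subgroup.centralizer (Q : Set G) := by
  refine Subgroup.commutator_le.2 fun g _ h _ ↦ Subgroup.mem_centralizer_iff.2 fun d hd ↦ ?_
  have hconj (x : G) : ∃ i : ℤ, d ^ i = x * d * x⁻¹ := Subgroup.mem_zpowers_iff.1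
    (conj_mem_zpowers_of_mem_powerNormalizer (hQ ▸ Subgroup.mem_top x) hd)
  obtain ⟨i, hi⟩ := hconj g⁻¹
  obtain ⟨j, hj⟩ := hconj h⁻¹
  have hcomm : g⁻¹ * (h⁻¹ * d * h⁻¹⁻¹) * g⁻¹⁻¹ = h⁻¹ * (g⁻¹ * d * g⁻¹⁻¹) * h⁻¹⁻¹ := by
    rw [← hi, ← hj, ← conj_zpow, ← conj_zpow, ← hi, ← hj, ← zpow_mul, ← zpow_mul, mul_comm]
  calc d * ⁅g, h⁆ = g * h * (h⁻¹ * (g⁻¹ * d * g⁻¹⁻¹) * h⁻¹⁻¹) * g⁻¹ * h⁻¹ := by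
        rw [commutatorElement_def]; group
    _ = ⁅g, h⁆ * d := by rw [← hcomm, commutatorElement_def]; group

/-- Comparing exponents in `x * (a * b) * x⁻¹ = (a * b) ^ s` leaves no room for a nontrivial
fixed point next to an element that `x` moves. -/
theorem commute_of_mem_powerNormalizer_of_commute {q : ℕ} (hq : q.Prime) {Q : Subgroup G}
    (hQ : IsPGroup q Q) {x a b : G} (hx : x ∈ powerNormalizer Q) (hxq : (orderOf x).Coprime q)
    (ha : a ∈ Q) (hb : b ∈ Q) (ha1 : a ≠ 1) (hab : Commute a b) (hxa : Commute x a) :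
    Commute x b := by
  by_contra hxb
  obtain ⟨k, hbk⟩ := exists_pow_prime_pow_eq_one hQ hb
  obtain ⟨l, hal⟩ := exists_pow_prime_pow_eq_one hQ ha
  obtain ⟨r, hr⟩ := Subgroup.mem_zpowers_iff.1 (conj_mem_zpowers_of_mem_powerNormalizer hx hb)
  obtain ⟨s, hs⟩ := Subgroup.mem_zpowers_iff.1
    (conj_mem_zpowers_of_mem_powerNormalizer hx (mul_mem ha hb))
  have hr1 : ¬ (q : ℤ) ∣ r - 1 := not_dvd_sub_one_of_not_commute hxq hbk hr.symm hxb
  have hpow : a ^ (1 - s) = b ^ (s - r) := by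
    have hconj : x * (a * b) * x⁻¹ = a * b ^ r := by
      rw [hr, ← mul_assoc, hxa.eq]; group
    rw [hconj, hab.mul_zpow] at hs
    rw [sub_eq_neg_add, zpow_add, zpow_neg, zpow_one, zpow_sub, inv_mul_eq_iff_eq_mul, ← mul_assoc,
      hs, mul_inv_cancel_right]
  have hb_fix : b ^ (s - r) = 1 := by
    by_contra hne
    have hcomm : Commute x (b ^ (s - r)) := hpow ▸ hxa.zpow_right (1 - s)
    refine hr1 (dvd_of_zpow_eq_one hq (k := k) ?_ hne ?_)
    · rw [← zpow_natCast, zpow_comm, zpow_natCast, hbk, one_zpow]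
    · rw [zpow_sub_one, mul_inv_eq_one, zpow_comm, hr, conj_zpow, hcomm.mul_inv_cancel]
  have hqb : (q : ℤ) ∣ s - r :=
    dvd_of_zpow_eq_one hq hbk (fun h ↦ hxb (h ▸ Commute.one_right x)) hb_fix
  have hqa : (q : ℤ) ∣ 1 - s := dvd_of_zpow_eq_one hq hal ha1 (hpow.trans hb_fix)
  exact hr1 (by simpa using (hqa.add hqb).neg_right)

theorem mem_zpowers_commutator_of_notMem_centralizer {q : ℕ} (hq : q.Prime)
    {Q : Subgroup G} [Finite Q] (hQ : IsPGroup q Q) {x : G} (hx : x ∈ powerNormalizer Q)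
    (hxq : (orderOf x).Coprime q) (hxQ : x ∉ Subgroup.centralizer (Q : Set G)) {d : G}
    (hd : d ∈ Q) : d ∈ Subgroup.zpowers ⁅x, d⁆ := by
  have := Fact.mk hq
  obtain ⟨e, he, hxe⟩ : ∃ e ∈ Q, ¬ Commute x e := by
    simpa [Subgroup.mem_centralizer_iff, Commute, SemiconjBy, eq_comm] using hxQ
  have : Nontrivial Q := (Subgroup.nontrivial_iff_exists_ne_one Q).2
    ⟨e, he, fun h ↦ hxe (h ▸ Commute.one_right x)⟩
  have := hQ.center_nontrivial
  obtain ⟨⟨⟨z, hz⟩, hzc⟩, hz1⟩ := exists_ne (1 : Subgroup.center Q)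
  have hz_comm {b : G} (hb : b ∈ Q) : Commute z b :=
    (congrArg Subtype.val (Subgroup.mem_center_iff.1 hzc ⟨b, hb⟩)).symm
  have hz1 : z ≠ 1 := fun h ↦ hz1 (Subtype.ext (Subtype.ext h))
  have hfree : d ≠ 1 → ¬ Commute x d := fun hd1 hxd ↦ hxe <|
    commute_of_mem_powerNormalizer_of_commute hq hQ hx hxq hz he hz1 (hz_comm he) <|
    commute_of_mem_powerNormalizer_of_commute hq hQ hx hxq hd hz hd1 (hz_comm hd).symm hxd
  rcases eq_or_ne d 1 with rfl | hd1
  · exact one_mem _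
  obtain ⟨k, hdk⟩ := exists_pow_prime_pow_eq_one hQ hd
  obtain ⟨r, hr⟩ := Subgroup.mem_zpowers_iff.1 (conj_mem_zpowers_of_mem_powerNormalizer hx hd)
  have hcomm : ⁅x, d⁆ = d ^ (r - 1) := by rw [zpow_sub_one, hr, commutatorElement_def]
  rw [hcomm]
  exact mem_zpowers_zpow_of_not_dvd hq hdk
    (not_dvd_sub_one_of_not_commute hxq hdk hr.symm (hfree hd1))

theorem isQuasinormalSubgroup_iff {A : Subgroup G} :
    IsQuasinormalSubgroup A ↔ ∀ a ∈ A, ∀ x : G, ∃ i : ℤ, x ^ i * a * x ∈ A := by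
  constructor
  · intro h a ha x
    have hax : a * x ∈ (A : Set G) * (Subgroup.zpowers x : Set G) :=
      Set.mul_mem_mul ha (Subgroup.mem_zpowers x)
    rw [h] at hax
    obtain ⟨_, ⟨i, rfl⟩, b, hb, hab⟩ := Set.mem_mul.1 hax
    refine ⟨-i, ?_⟩
    rw [mul_assoc, ← hab]
    simpa using hb
  · intro h X
    have hle : (A : Set G) * (X : Set G) ⊆ (X : Set G) * (A : Set G) := by
      rintro _ ⟨a, ha, x, hx, rfl⟩
      obtain ⟨i, hi⟩ := h a ha x
      exact ⟨x ^ (-i), X.zpow_mem hx _, _, hi, by simp [mul_assoc]⟩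
    refine hle.antisymm ?_
    simpa [mul_inv_rev] using Set.inv_subset_inv.2 hle

theorem isQuasinormalSubgroup_of_normal {A : Subgroup G} [hA : A.Normal] :
    IsQuasinormalSubgroup A :=
  isQuasinormalSubgroup_iff.2 fun a ha x ↦ ⟨-1, by simpa using hA.conj_mem' a ha x⟩

namespace IsPTGroup

theorem of_surjective {G' : Type*} [Group G'] (hPT : IsPTGroup G) (f : G →* G')
    (hf : Function.Surjective f) : IsPTGroup G' := by
  intro H K hHK hH hK
  rw [isQuasinormalSubgroup_iff] at hH hK
  have h := hPT (H.comap f) (K.comap f) (Subgroup.comap_mono hHK)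
    (isQuasinormalSubgroup_iff.2 ?_) (isQuasinormalSubgroup_iff.2 ?_)
  · rw [isQuasinormalSubgroup_iff] at h ⊢
    intro a ha x
    obtain ⟨a, rfl⟩ := hf a
    obtain ⟨x, rfl⟩ := hf x
    simpa using h a ha x
  · rintro ⟨a, ha⟩ h ⟨x, hx⟩
    simpa [Subgroup.mem_subgroupOf] using hH ⟨f a, ha⟩ h ⟨f x, hx⟩
  · intro a ha x
    simpa using hK (f a) ha (f x)

theorem isQuasinormalSubgroup_of_isSubnormal (hPT : IsPTGroup G) {H : Subgroup G}
    (hH : H.IsSubnormal) : IsQuasinormalSubgroup H := by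
  induction hH with
  | top => exact isQuasinormalSubgroup_of_normal
  | step H K hHK _ _ ih => exact hPT H K hHK isQuasinormalSubgroup_of_normal ih

end IsPTGroup

theorem isSubnormal_of_lowerCentralSeries_le {A : Subgroup G} {n : ℕ}
    (hA : (⊤ : Subgroup G).lowerCentralSeries n ≤ A) : A.IsSubnormal := by
  have hchain (k : ℕ) : (A ⊔ (⊤ : Subgroup G).lowerCentralSeries k).IsSubnormal := by
    induction k with
    | zero => simp [Subgroup.IsSubnormal.top]
    | succ k ih =>
      refine .step _ _ (sup_le_sup_left (Subgroup.lowerCentralSeries_antitone _ k.le_succ) A) ih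
        (Subgroup.normal_subgroupOf_of_le_normalizer
          (sup_le (le_sup_left.trans Subgroup.le_normalizer) ?_))
      exact Subgroup.le_normalizer_iff_commutator_le_right.2
        ((Subgroup.commutator_mono le_rfl le_top).trans le_sup_right)
  simpa [sup_eq_left.2 hA] using hchain n

theorem isSubnormal_of_le_of_isNilpotent {H N : Subgroup G} [hN : N.Normal] [Group.IsNilpotent N]
    (hH : H ≤ N) : H.IsSubnormal := by
  obtain ⟨n, hn⟩ := Subgroup.nilpotent_iff_lowerCentralSeries.1 ‹Group.IsNilpotent N›
  exact .trans hH (isSubnormal_of_lowerCentralSeries_le (hn.trans_le bot_le)) hN.isSubnormal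

namespace IsPTGroup

/-- Quasinormality of `H` puts `x * a * x⁻¹` into `x ^ i * H` for some `i`; that power of `x` lies
in `N`, so it is trivial. -/
theorem mem_powerNormalizer [Finite G] (hPT : IsPTGroup G) {q : ℕ} [Fact q.Prime] {N : Subgroup G}
    [hN : N.Normal] (hq : IsPGroup q N) {x : G} (hx : (orderOf x).Coprime q) :
    x ∈ powerNormalizer N := by
  refine mem_powerNormalizer_of_forall_conj_mem fun H hH a ha ↦ ?_
  have := hq.isNilpotent
  obtain ⟨i, hi⟩ := isQuasinormalSubgroup_iff.1
    (hPT.isQuasinormalSubgroup_of_isSubnormal (isSubnormal_of_le_of_isNilpotent hH)) a ha x⁻¹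
  have hmem : x⁻¹ ^ (i + 1) ∈ N := by
    have h := N.mul_mem (hH hi) (N.inv_mem (hN.conj_mem a (hH ha) x))
    rwa [show x⁻¹ ^ i * a * x⁻¹ * (x * a * x⁻¹)⁻¹ = x⁻¹ ^ (i + 1) by group] at h
  obtain ⟨k, hk⟩ := exists_pow_prime_pow_eq_one hq hmem
  have hone : x⁻¹ ^ (i + 1) = 1 := by
    refine eq_one_of_pow_eq_one_of_coprime (m := orderOf x) ?_ hk (hx.pow_right k)
    rw [← zpow_natCast, zpow_comm, zpow_natCast, inv_pow, pow_orderOf_eq_one, inv_one, one_zpow]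
  rwa [eq_inv_of_mul_eq_one_left ((zpow_add_one _ i).symm.trans hone), inv_inv] at hi

end IsPTGroup

theorem exists_ne_bot_normal_isMulCommutative [Group.IsSolvable G] [Nontrivial G] :
    ∃ A : Subgroup G, A.Normal ∧ A ≠ ⊥ ∧ IsMulCommutative A := by
  classical
  have hex : ∃ n, derivedSeries G n = ⊥ := (Group.isSolvable_def G).1 inferInstance
  obtain ⟨m, hm⟩ : ∃ m, Nat.find hex = m + 1 :=
    Nat.exists_eq_succ_of_ne_zero fun h ↦ top_ne_bot ((Nat.find_eq_zero hex).1 h)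
  refine ⟨derivedSeries G m, inferInstance, Nat.find_min hex (by lia), ?_⟩
  rw [← Subgroup.commutator_self_eq_bot_iff, ← derivedSeries_succ, ← hm]
  exact Nat.find_spec hex

theorem exists_ne_bot_normal_isPGroup [Finite G] [Group.IsSolvable G] [Nontrivial G] :
    ∃ p : ℕ, p.Prime ∧ ∃ N : Subgroup G, N.Normal ∧ N ≠ ⊥ ∧ IsPGroup p N := by
  obtain ⟨A, hA, hA_ne, hA_comm⟩ := exists_ne_bot_normal_isMulCommutative (G := G)
  obtain ⟨p, hp, hpA⟩ := Nat.exists_prime_and_dvd (mt Subgroup.card_eq_one.1 hA_ne)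
  have := Fact.mk hp
  let P : Sylow p A := default
  have := P.characteristic_of_normal inferInstance
  refine ⟨p, hp, (P : Subgroup A).map A.subtype, inferInstance, ?_, P.2.map _⟩
  rw [Ne, Subgroup.map_eq_bot_iff_of_injective _ A.subtype_injective]
  exact P.ne_bot_of_dvd_card hpA

theorem coprime_totient_of_lt {p q : ℕ} (hp : p.Prime) (hq : q.Prime) (hpq : p < q) (k : ℕ) :
    q.Coprime (p ^ k).totient := by
  refine .coprime_dvd_right (Nat.totient_dvd_of_dvd (pow_dvd_pow p k.le_succ)) ?_
  rw [Nat.totient_prime_pow_succ hp]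
  refine .mul_right (((Nat.coprime_primes hq hp).2 hpq.ne').pow_right k) ?_
  exact Nat.coprime_of_lt_prime (Nat.sub_pos_of_lt hp.one_lt).ne' (by lia) hq

theorem normal_sylow_of_le_normalizer [Finite G] {q : ℕ} [Fact q.Prime] (P : Sylow q G)
    {N : Subgroup G} (hPN : ((P : Subgroup G) ⊔ N).Normal)
    (hN : N ≤ Subgroup.normalizer (P : Set G)) : (P : Subgroup G).Normal := by
  have hfrattini : Subgroup.normalizer (P : Set G) ⊔ ((P : Subgroup G) ⊔ N) = ⊤ :=
    P.normalizer_sup_eq_top' le_sup_left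
  refine Subgroup.normalizer_eq_top_iff.1 (top_le_iff.1 ?_)
  exact hfrattini.ge.trans (sup_le le_rfl (sup_le Subgroup.le_normalizer hN))

namespace IsPTGroup

/-- If `p < q`, a `q`-element inducing power automorphisms on a `p`-group centralises it. -/
theorem le_normalizer_sylow [Finite G] (hPT : IsPTGroup G) {p q : ℕ} [Fact p.Prime] [Fact q.Prime]
    (hpq : p ≤ q) {N : Subgroup G} [N.Normal] (hN : IsPGroup p N) (P : Sylow q G) :
    N ≤ Subgroup.normalizer (P : Set G) := by
  rcases hpq.eq_or_lt with rfl | hlt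
  · exact (hN.le_sylow_of_normal P).trans Subgroup.le_normalizer
  refine .trans (fun a ha ↦ Subgroup.mem_centralizer_iff.2 fun x hx ↦ ?_)
    (Subgroup.centralizer_le_normalizer _)
  obtain ⟨k, hk⟩ := exists_pow_prime_pow_eq_one P.isPGroup' hx
  obtain ⟨l, hl⟩ := exists_pow_prime_pow_eq_one hN ha
  have hpq_coprime := (Nat.coprime_primes (Fact.out : q.Prime) (Fact.out : p.Prime)).2 hlt.ne'
  have hx_order : orderOf x ∣ q ^ k := orderOf_dvd_of_pow_eq_one hk
  refine commute_of_coprime_totient (conj_mem_zpowers_of_mem_powerNormalizer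
    (hPT.mem_powerNormalizer hN ?_) ha) (isOfFinOrder_of_finite x) ?_
  · exact (hpq_coprime.pow_left k).coprime_dvd_left hx_order
  · exact ((coprime_totient_of_lt Fact.out Fact.out hlt l).pow_left k).coprime_dvd_left hx_order
      |>.coprime_dvd_right (Nat.totient_dvd_of_dvd (orderOf_dvd_of_pow_eq_one hl))

theorem normal_sylow_of_forall_prime_le (hPT : IsPTGroup G) [Finite G] [Group.IsSolvable G] {q : ℕ}
    [Fact q.Prime] (hq : ∀ p : ℕ, p.Prime → p ∣ Nat.card G → p ≤ q) (P : Sylow q G) :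
    (P : Subgroup G).Normal := by
  induction hn : Nat.card G using Nat.strong_induction_on generalizing G with
  | _ n ih =>
  subst hn
  rcases subsingleton_or_nontrivial G with _ | _
  · exact ⟨fun x hx g ↦ by rwa [Subsingleton.elim (g * x * g⁻¹) x]⟩
  obtain ⟨p, hp, N, hN, hN_ne, hpN⟩ := exists_ne_bot_normal_isPGroup (G := G)
  have := Fact.mk hp
  have hcard := N.card_eq_card_quotient_mul_card_subgroup
  have hlt : Nat.card (G ⧸ N) < Nat.card G := by
    rw [hcard]
    exact lt_mul_of_one_lt_right Nat.card_pos (N.one_lt_card_iff_ne_bot.2 hN_ne)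
  have hquot := ih _ hlt (hPT.of_surjective _ (QuotientGroup.mk'_surjective N))
    (fun r hr hrc ↦ hq r hr (hrc.trans (Dvd.intro _ hcard.symm)))
    (P.mapSurjective (QuotientGroup.mk'_surjective N)) rfl
  have hP_sup : ((P : Subgroup G) ⊔ N).Normal := by
    rw [Sylow.coe_mapSurjective] at hquot
    rw [sup_comm, ← QuotientGroup.comap_map_mk']
    exact hquot.comap _
  have hpG : p ∣ Nat.card G :=
    (hpN.card_eq_or_dvd.resolve_left (N.one_lt_card_iff_ne_bot.2 hN_ne).ne').trans
      N.card_subgroup_dvd_card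
  exact normal_sylow_of_le_normalizer P hP_sup (hPT.le_normalizer_sylow (hq p hp hpG) hpN P)

end IsPTGroup

variable (G) in
/-- The nilpotent residual of a finite group, the smallest normal subgroup with nilpotent quotient,
encoded as the limit of the lower central series. -/
def nilpotentResidual : Subgroup G :=
  ⨅ n, (⊤ : Subgroup G).lowerCentralSeries n

instance nilpotentResidual_normal : (nilpotentResidual G).Normal :=
  Subgroup.normal_iInf_normal fun _ ↦ inferInstance

variable (G) in
theorem exists_lowerCentralSeries_eq_nilpotentResidual [Finite G] :
    ∃ n, (⊤ : Subgroup G).lowerCentralSeries n = nilpotentResidual G := by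
  obtain ⟨n, hn⟩ := WellFoundedGT.monotone_chain_condition (α := (Subgroup G)ᵒᵈ)
    ⟨_, (Subgroup.lowerCentralSeries_antitone (⊤ : Subgroup G)).dual_right⟩
  refine ⟨n, le_antisymm (le_iInf fun m ↦ ?_) (iInf_le _ n)⟩
  rcases le_total n m with h | h
  · exact le_of_eq (hn m h)
  · exact Subgroup.lowerCentralSeries_antitone _ h

theorem nilpotentResidual_le_commutator : nilpotentResidual G ≤ commutator G :=
  iInf_le (fun n ↦ (⊤ : Subgroup G).lowerCentralSeries n) 1

theorem map_nilpotentResidual [Finite G] {G' : Type*} [Group G'] {f : G →* G'}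
    (hf : Function.Surjective f) : (nilpotentResidual G).map f = nilpotentResidual G' := by
  have hmap (n : ℕ) : ((⊤ : Subgroup G).lowerCentralSeries n).map f =
      (⊤ : Subgroup G').lowerCentralSeries n := by
    rw [Subgroup.map_lowerCentralSeries, Subgroup.map_top_of_surjective f hf]
  obtain ⟨n, hn⟩ := exists_lowerCentralSeries_eq_nilpotentResidual G
  refine le_antisymm (le_iInf fun m ↦ ?_) ?_
  · exact hmap m ▸ Subgroup.map_mono (iInf_le _ m)
  · exact (iInf_le _ n).trans (hn ▸ (hmap n).ge)

theorem nilpotentResidual_le {N : Subgroup G} [N.Normal] [hN : Group.IsNilpotent (G ⧸ N)] :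
    nilpotentResidual G ≤ N := by
  obtain ⟨n, hn⟩ := Subgroup.nilpotent_iff_lowerCentralSeries.1 hN
  refine (iInf_le _ n).trans ?_
  rw [← QuotientGroup.ker_mk' N, ← Subgroup.map_eq_bot_iff, Subgroup.map_lowerCentralSeries,
    Subgroup.map_top_of_surjective _ (QuotientGroup.mk'_surjective N), hn]

variable (G) in
/-- The structure of soluble `PT`-groups (Zacher): the nilpotent residual is a Hall subgroup all of
whose subgroups are normal in `G`. -/
structure IsZacherGroup : Prop where
  normal_of_le : ∀ H ≤ nilpotentResidual G, H.Normal
  coprime_card_index : (Nat.card (nilpotentResidual G)).Coprime (nilpotentResidual G).index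

namespace IsZacherGroup

theorem of_inf_eq_bot [Finite G] {Q R : Subgroup G} [Q.Normal] (h : IsZacherGroup (G ⧸ Q))
    (hQ : (Nat.card Q).Coprime Q.index) (hR : R.Normal) (hQR : Q ⊓ R = ⊥)
    (hDR : nilpotentResidual G ≤ R) : IsZacherGroup G := by
  have hmap := map_nilpotentResidual (QuotientGroup.mk'_surjective Q)
  refine ⟨fun H hH ↦ ⟨fun x hx g ↦ ?_⟩, ?_⟩
  · have hHn := h.normal_of_le _ ((Subgroup.map_mono hH).trans hmap.le)
    obtain ⟨y, hy, hyx⟩ := hHn.conj_mem _ (Subgroup.mem_map_of_mem _ hx) (QuotientGroup.mk' Q g)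
    have : y⁻¹ * (g * x * g⁻¹) ∈ Q ⊓ R :=
      ⟨QuotientGroup.eq.1 hyx, R.mul_mem (R.inv_mem (hDR (hH hy))) (hR.conj_mem _ (hDR (hH hx)) g)⟩
    rw [hQR, Subgroup.mem_bot, inv_mul_eq_one] at this
    rwa [← this]
  · have hcard : Nat.card (nilpotentResidual G) = Nat.card (nilpotentResidual (G ⧸ Q)) := by
      have hDQ : Q ⊓ nilpotentResidual G = ⊥ := le_bot_iff.1 (hQR ▸ inf_le_inf_left Q hDR)
      rw [← hmap, ← Subgroup.relIndex_ker, QuotientGroup.ker_mk', ← Subgroup.inf_relIndex_right,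
        hDQ, Subgroup.relIndex_bot_left]
    have hindex : (nilpotentResidual G).index ∣
        Nat.card Q * (nilpotentResidual (G ⧸ Q)).index := by
      rw [← hmap, Subgroup.index_map, QuotientGroup.ker_mk', QuotientGroup.range_mk',
        Subgroup.index_top, mul_one, ← Subgroup.relIndex_mul_index le_sup_left,
        Subgroup.relIndex_sup_left]
      exact mul_dvd_mul_right (Subgroup.relIndex_dvd_card _ _) _
    refine .coprime_dvd_right hindex (.mul_right ?_ (hcard ▸ h.coprime_card_index))
    rw [hcard]
    refine (hQ.coprime_dvd_right ?_).symm
    rw [Subgroup.index_eq_card]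
    exact Subgroup.card_subgroup_dvd_card _

theorem conj_mem_zpowers_of_primePow [Finite G] {Q : Subgroup G} [Q.Normal]
    (h : IsZacherGroup (G ⧸ Q)) (hQ : (Nat.card Q).Coprime Q.index) (hQtop : powerNormalizer Q = ⊤)
    {d : G} (hd : d ∈ nilpotentResidual G) {p k : ℕ} (hp : p.Prime) (hdk : d ^ p ^ k = 1) (g : G) :
    g * d * g⁻¹ ∈ Subgroup.zpowers d := by
  by_cases hpQ : p ∣ Nat.card Q
  · exact conj_mem_zpowers_of_mem_powerNormalizer (hQtop ▸ Subgroup.mem_top g)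
      (mem_of_pow_eq_one_of_coprime_index hdk ((hQ.coprime_dvd_left hpQ).pow_left k))
  have hmap := map_nilpotentResidual (QuotientGroup.mk'_surjective Q)
  have hd_quot : QuotientGroup.mk' Q d ∈ nilpotentResidual (G ⧸ Q) :=
    hmap.le (Subgroup.mem_map_of_mem _ hd)
  obtain ⟨i, hi⟩ := Subgroup.mem_zpowers_iff.1 <|
    (h.normal_of_le _ (Subgroup.zpowers_le.2 hd_quot)).conj_mem _ (Subgroup.mem_zpowers _)
      (QuotientGroup.mk' Q g)
  obtain ⟨y, hy, hyd⟩ : ∃ y ∈ Q, d ^ i * y = g * d * g⁻¹ :=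
    ⟨(d ^ i)⁻¹ * (g * d * g⁻¹), QuotientGroup.eq.1 hi, mul_inv_cancel_left _ _⟩
  have hcomm : Commute (d ^ i) y := .zpow_left
    (Subgroup.mem_centralizer_iff.1 (commutator_le_centralizer_of_powerNormalizer_eq_top hQtop
      (nilpotentResidual_le_commutator hd)) y hy).symm i
  have hyk : y ^ p ^ k = 1 := by
    have hpow := congrArg (· ^ p ^ k) hyd
    rwa [hcomm.mul_pow, conj_pow, hdk, mul_one, mul_inv_cancel, ← zpow_natCast, zpow_comm,
      zpow_natCast, hdk, one_zpow, one_mul] at hpow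
  have hy1 : y = 1 := eq_one_of_pow_eq_one_of_coprime hyk
    (orderOf_dvd_iff_pow_eq_one.1 (Subgroup.orderOf_dvd_natCard Q hy))
    (((Nat.Prime.coprime_iff_not_dvd hp).2 hpQ).pow_left k)
  exact Subgroup.mem_zpowers_iff.2 ⟨i, by rw [← hyd, hy1, mul_one]⟩

theorem of_powerNormalizer_eq_top [Finite G] {Q : Subgroup G} [Q.Normal]
    (h : IsZacherGroup (G ⧸ Q)) (hQ : (Nat.card Q).Coprime Q.index) (hQtop : powerNormalizer Q = ⊤)
    (hQD : Q ≤ nilpotentResidual G) : IsZacherGroup G := by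
  have hmap := map_nilpotentResidual (QuotientGroup.mk'_surjective Q)
  refine ⟨fun H hH ↦ ⟨fun a ha g ↦ ?_⟩, ?_⟩
  · have hconj : H ≤ H.comap (MulAut.conj g).toMonoidHom :=
      le_of_forall_primePow_mem fun x hx p hp k hk ↦
        Subgroup.zpowers_le.2 hx (h.conj_mem_zpowers_of_primePow hQ hQtop (hH hx) hp hk g)
    exact hconj ha
  have hindex : (nilpotentResidual G).index = (nilpotentResidual (G ⧸ Q)).index := by
    rw [← hmap, Subgroup.index_map_eq _ (QuotientGroup.mk'_surjective Q) (by simpa)]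
  have hcard : Nat.card (nilpotentResidual G) =
      Nat.card Q * Nat.card (nilpotentResidual (G ⧸ Q)) := by
    rw [← hmap, ← Subgroup.relIndex_ker, QuotientGroup.ker_mk', ← Subgroup.relIndex_bot_left Q,
      Subgroup.relIndex_mul_relIndex _ _ _ bot_le hQD, Subgroup.relIndex_bot_left]
  rw [hcard, hindex]
  refine .mul_left (hQ.coprime_dvd_right ?_) h.coprime_card_index
  rw [← hindex]
  exact Subgroup.index_dvd_of_le hQD

end IsZacherGroup

theorem le_nilpotentResidual_of_mem_zpowers_commutator {Q : Subgroup G} {x : G}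
    (hx : ∀ d ∈ Q, d ∈ Subgroup.zpowers ⁅x, d⁆) : Q ≤ nilpotentResidual G := by
  refine le_iInf fun n ↦ ?_
  induction n with
  | zero => exact le_top
  | succ n ih =>
    intro d hd
    refine Subgroup.zpowers_le.2 ?_ (hx d hd)
    rw [Subgroup.lowerCentralSeries_succ, Subgroup.commutator_comm]
    exact Subgroup.commutator_mem_commutator (Subgroup.mem_top x) (ih hd)

theorem exists_normal_isComplement' [Finite G] {q : ℕ} {Q : Subgroup G} [Q.Normal]
    (hHall : (Nat.card Q).Coprime Q.index) (hQ : q.Coprime Q.index)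
    (hcent : ∀ x : G, (orderOf x).Coprime q → x ∈ Subgroup.centralizer (Q : Set G)) :
    ∃ R : Subgroup G, R.Normal ∧ Q.IsComplement' R := by
  obtain ⟨R, hR⟩ := Subgroup.exists_right_complement'_of_coprime hHall
  refine ⟨R, Subgroup.normalizer_eq_top_iff.1 (top_le_iff.1 ?_), hR⟩
  have hRQ : R ≤ Subgroup.centralizer (Q : Set G) := fun x hx ↦
    hcent x ((hR.symm.index_eq_card ▸ hQ).symm.coprime_dvd_left
      (Subgroup.orderOf_dvd_natCard R hx))
  rw [← hR.sup_eq_top]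
  exact sup_le ((Subgroup.le_centralizer_iff.1 hRQ).trans (Subgroup.centralizer_le_normalizer _))
    Subgroup.le_normalizer

namespace IsPTGroup

theorem powerNormalizer_eq_top_of_forall_mem_zpowers [Finite G] (hPT : IsPTGroup G) {q : ℕ}
    [Fact q.Prime] {Q : Subgroup G} [Q.Normal] (hqQ : IsPGroup q Q) (hQ : q.Coprime Q.index) {x : G}
    (hxq : (orderOf x).Coprime q) (hx : ∀ d ∈ Q, d ∈ Subgroup.zpowers ⁅x, d⁆) :
    powerNormalizer Q = ⊤ := by
  have hxQ := hPT.mem_powerNormalizer hqQ hxq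
  have hQ_le : Q ≤ powerNormalizer Q := fun d hd ↦
    Subgroup.zpowers_le.2 (Subgroup.commutator_le_left _ _
      (Subgroup.commutator_mem_commutator hxQ (Subgroup.mem_top d))) (hx d hd)
  refine top_le_iff.1 (le_of_forall_primePow_mem fun y _ p hp k hy ↦ ?_)
  rcases eq_or_ne p q with rfl | hpq
  · exact hQ_le (mem_of_pow_eq_one_of_coprime_index hy (hQ.pow_left k))
  · exact hPT.mem_powerNormalizer hqQ <| (((Nat.coprime_primes hp Fact.out).2 hpq).pow_left k)
      |>.coprime_dvd_left (orderOf_dvd_of_pow_eq_one hy)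

theorem isZacherGroup_of_quotient [Finite G] (hPT : IsPTGroup G) {q : ℕ} [hq : Fact q.Prime]
    {Q : Subgroup G} [Q.Normal] (hqQ : IsPGroup q Q) (hQ : q.Coprime Q.index)
    (h : IsZacherGroup (G ⧸ Q)) : IsZacherGroup G := by
  obtain ⟨n, hn⟩ := hqQ.exists_card_eq
  have hHall : (Nat.card Q).Coprime Q.index := hn ▸ hQ.pow_left n
  by_cases hcent : ∃ x : G, (orderOf x).Coprime q ∧ x ∉ Subgroup.centralizer (Q : Set G)
  · obtain ⟨x, hxq, hxQ⟩ := hcent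
    have hx : ∀ d ∈ Q, d ∈ Subgroup.zpowers ⁅x, d⁆ := fun d hd ↦
      mem_zpowers_commutator_of_notMem_centralizer hq.out hqQ (hPT.mem_powerNormalizer hqQ hxq)
        hxq hxQ hd
    exact h.of_powerNormalizer_eq_top hHall
      (hPT.powerNormalizer_eq_top_of_forall_mem_zpowers hqQ hQ hxq hx)
      (le_nilpotentResidual_of_mem_zpowers_commutator hx)
  · push Not at hcent
    obtain ⟨R, hRn, hR⟩ := exists_normal_isComplement' hHall hQ hcent
    have := (IsPGroup.of_card (G := G ⧸ R) (p := q) (n := n)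
      (by rw [← Subgroup.index_eq_card, hR.index_eq_card, hn])).isNilpotent
    exact h.of_inf_eq_bot hHall hRn hR.disjoint.eq_bot nilpotentResidual_le

theorem isZacherGroup (hPT : IsPTGroup G) [Finite G] [Group.IsSolvable G] : IsZacherGroup G := by
  induction hn : Nat.card G using Nat.strong_induction_on generalizing G with
  | _ n ih =>
  subst hn
  rcases subsingleton_or_nontrivial G with _ | _
  · exact ⟨fun H _ ↦ ⟨fun x hx g ↦ by rwa [Subsingleton.elim (g * x * g⁻¹) x]⟩,
      by simp [Subgroup.eq_bot_of_subsingleton (nilpotentResidual G)]⟩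
  obtain ⟨q, hqG, hq_max⟩ := (Nat.card G).primeFactors.exists_max_image id
    (Nat.nonempty_primeFactors.2 Finite.one_lt_card)
  obtain ⟨hq, hq_dvd, -⟩ := Nat.mem_primeFactors.1 hqG
  have := Fact.mk hq
  let Q : Sylow q G := default
  have hQ : (Q : Subgroup G).Normal := hPT.normal_sylow_of_forall_prime_le (q := q)
    (fun p hp hpG ↦ hq_max p (Nat.mem_primeFactors.2 ⟨hp, hpG, Nat.card_pos.ne'⟩)) Q
  refine hPT.isZacherGroup_of_quotient Q.2 ((hq.coprime_iff_not_dvd).2 Q.not_dvd_index)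
    (ih _ ?_ (hPT.of_surjective _ (QuotientGroup.mk'_surjective (Q : Subgroup G))) rfl)
  rw [(Q : Subgroup G).card_eq_card_quotient_mul_card_subgroup]
  exact lt_mul_of_one_lt_right Nat.card_pos (Subgroup.one_lt_card_iff_ne_bot _ |>.2
    (Q.ne_bot_of_dvd_card hq_dvd))

end IsPTGroup

theorem isModularSubgroup_of_le {M : Subgroup G}
    (h₁ : ∀ X Z : Subgroup G, X ≤ Z → (X ⊔ M) ⊓ Z ≤ X ⊔ (M ⊓ Z))
    (h₂ : ∀ Y Z : Subgroup G, M ≤ Z → (M ⊔ Y) ⊓ Z ≤ M ⊔ (Y ⊓ Z)) : IsModularSubgroup M :=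
  ⟨fun X Z hXZ ↦ (h₁ X Z hXZ).antisymm'
      (sup_le (le_inf le_sup_left hXZ) (inf_le_inf_right Z le_sup_right)),
    fun Y Z hMZ ↦ (h₂ Y Z hMZ).antisymm'
      (sup_le (le_inf le_sup_left hMZ) (inf_le_inf_right Z le_sup_right))⟩

theorem isModularSubgroup_of_normal {N : Subgroup G} (hN : N.Normal) : IsModularSubgroup N := by
  refine isModularSubgroup_of_le (fun X Z hXZ ↦ ?_) (fun Y Z hNZ ↦ ?_)
  · rintro _ ⟨ht, hxn⟩
    obtain ⟨x, hx, n, hn, rfl⟩ := Subgroup.mem_sup_of_normal_right.1 ht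
    exact mul_mem (Subgroup.mem_sup_left hx)
      (Subgroup.mem_sup_right ⟨hn, (Z.mul_mem_cancel_left (hXZ hx)).1 hxn⟩)
  · rintro _ ⟨ht, hny⟩
    obtain ⟨n, hn, y, hy, rfl⟩ := Subgroup.mem_sup_of_normal_left.1 ht
    exact mul_mem (Subgroup.mem_sup_left hn)
      (Subgroup.mem_sup_right ⟨hy, (Z.mul_mem_cancel_left (hNZ hn)).1 hny⟩)

theorem isModularSubgroup_of_forall_inf_covBy {M : Subgroup G}
    (h : ∀ Z, ¬ Z ≤ M → M ⊓ Z ⋖ Z) : IsModularSubgroup M := by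
  refine isModularSubgroup_of_le (fun X Z hXZ ↦ ?_) (fun Y Z hMZ ↦ ?_)
  · by_cases hZM : Z ≤ M
    · exact inf_le_right.trans ((le_inf hZM le_rfl).trans le_sup_right)
    rcases (h Z hZM).eq_or_eq le_sup_right (sup_le hXZ inf_le_right) with hX | hX
    · have hXM : X ≤ M := (le_sup_left.trans hX.le).trans inf_le_left
      exact (inf_le_inf_right Z (sup_le hXM le_rfl)).trans le_sup_right
    · exact inf_le_right.trans hX.ge
  · by_cases hYM : Y ≤ M
    · exact inf_le_left.trans ((sup_le le_rfl hYM).trans le_sup_left)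
    have hcov : M ⋖ M ⊔ Y := by
      simpa using h (M ⊔ Y) (fun hle ↦ hYM (le_sup_right.trans hle))
    rcases hcov.eq_or_eq (le_inf le_sup_left hMZ) inf_le_left with hY | hY
    · exact hY.le.trans le_sup_left
    · have hYZ : Y ≤ Z := (le_sup_right.trans hY.ge).trans inf_le_right
      exact inf_le_left.trans (sup_le_sup_left (le_inf le_rfl hYZ) M)

theorem inf_covBy_of_prime_relIndex {M Z : Subgroup G} (h : (M.relIndex Z).Prime) : M ⊓ Z ⋖ Z := by
  refine ⟨lt_of_le_of_ne inf_le_right fun heq ↦ h.ne_one ?_, fun W hMW hWZ ↦ ?_⟩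
  · exact Subgroup.relIndex_eq_one.2 (inf_eq_right.1 heq)
  have hmul := Subgroup.relIndex_mul_relIndex _ _ _ hMW.le hWZ.le
  rw [Subgroup.inf_relIndex_right] at hmul
  rcases Nat.prime_mul_iff.1 (hmul ▸ h) with ⟨-, hW⟩ | ⟨-, hW⟩
  · exact hWZ.not_ge (Subgroup.relIndex_eq_one.1 hW)
  · exact hMW.not_ge (Subgroup.relIndex_eq_one.1 hW)

theorem prime_of_dvd_prime_mul_prime {n p r : ℕ} (hp : p.Prime) (hr : r.Prime) (h : n ∣ p * r)
    (h1 : n ≠ 1) (hne : n ≠ p * r) : n.Prime := by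
  obtain ⟨a, b, ha, hb, rfl⟩ := Nat.dvd_mul.1 h
  rcases (Nat.dvd_prime hp).1 ha with rfl | rfl <;>
    rcases (Nat.dvd_prime hr).1 hb with rfl | rfl <;> simp_all

theorem isModularSubgroup_of_index_dvd_prime_mul_prime {N M : Subgroup G} [hN : N.Normal]
    {p r : ℕ} (hp : p.Prime) (hr : r.Prime) (hNpr : N.index ∣ p * r) (hNM : N ≤ M) :
    IsModularSubgroup M := by
  have hpr : 0 < p * r := Nat.mul_pos hp.pos hr.pos
  have : N.FiniteIndex := ⟨ne_zero_of_dvd_ne_zero hpr.ne' hNpr⟩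
  rcases hNM.eq_or_lt with rfl | hlt
  · exact isModularSubgroup_of_normal hN
  refine isModularSubgroup_of_forall_inf_covBy fun Z hZM ↦ inf_covBy_of_prime_relIndex <|
    prime_of_dvd_prime_mul_prime hp hr ?_ (mt Subgroup.relIndex_eq_one.1 hZM) (ne_of_lt ?_)
  · exact (Subgroup.relIndex_dvd_of_le_left Z hNM).trans
      ((Subgroup.relIndex_dvd_index_of_normal N Z).trans hNpr)
  · have : M.FiniteIndex := Subgroup.finiteIndex_of_le hNM
    calc M.relIndex Z ≤ M.relIndex ⊤ := Subgroup.relIndex_le_of_le_right le_top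
          (by simpa using Subgroup.FiniteIndex.index_ne_zero)
      _ = M.index := M.relIndex_top_right
      _ < N.index := Subgroup.index_strictAnti hlt
      _ ≤ p * r := Nat.le_of_dvd hpr hNpr

theorem IsModularSubgroup.sup {M₁ M₂ : Subgroup G} (h₁ : IsModularSubgroup M₁)
    (h₂ : IsModularSubgroup M₂) : IsModularSubgroup (M₁ ⊔ M₂) := by
  refine isModularSubgroup_of_le (fun X W hXW ↦ ?_) (fun Y Z hZ ↦ ?_)
  · set Z := (X ⊔ (M₁ ⊔ M₂)) ⊓ W
    set T := Z ⊓ (M₁ ⊔ M₂)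
    have hXZ : X ≤ Z := le_inf le_sup_left hXW
    have hsup : X ⊔ T ⊔ M₁ = M₁ ⊔ Z :=
      calc X ⊔ T ⊔ M₁ = X ⊔ (M₁ ⊔ (Z ⊓ (M₁ ⊔ M₂))) := by rw [sup_assoc, sup_comm T]
        _ = X ⊔ (M₁ ⊔ (M₂ ⊓ (M₁ ⊔ Z))) := by
          rw [h₁.2 _ _ le_sup_left, h₁.2 _ _ le_sup_left, inf_comm]
        _ = (X ⊔ (M₁ ⊔ M₂)) ⊓ (M₁ ⊔ Z) := by
          rw [← sup_assoc, h₂.1 _ _ (sup_le (hXZ.trans le_sup_right) le_sup_left), sup_assoc]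
        _ = M₁ ⊔ Z := inf_eq_right.2 (sup_le (le_sup_left.trans le_sup_right) inf_le_left)
    calc Z = (X ⊔ T ⊔ M₁) ⊓ Z := by rw [hsup, inf_eq_right.2 le_sup_right]
      _ = X ⊔ T ⊔ (M₁ ⊓ Z) := (h₁.1 _ _ (sup_le hXZ inf_le_left)).symm
      _ ≤ X ⊔ ((M₁ ⊔ M₂) ⊓ W) := sup_le
        (sup_le_sup_left (le_inf inf_le_right (inf_le_left.trans inf_le_right)) X)
        ((inf_le_inf le_sup_left inf_le_right).trans le_sup_right)
  · rw [sup_assoc, sup_assoc, h₂.2 _ _ (le_sup_right.trans hZ), h₁.2 _ _ (le_sup_left.trans hZ)]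

theorem card_sup_of_coprime {A B : Subgroup G} [B.Normal]
    (h : (Nat.card A).Coprime (Nat.card B)) : Nat.card ↥(A ⊔ B) = Nat.card A * Nat.card B := by
  have hrel : B.relIndex (A ⊔ B) = Nat.card A := by
    rw [Subgroup.relIndex_sup_right, ← Subgroup.inf_relIndex_right, inf_comm,
      (Subgroup.disjoint_of_coprime_natCard h).eq_bot, Subgroup.relIndex_bot_left]
  simpa [hrel, mul_comm, eq_comm] using
    Subgroup.relIndex_mul_relIndex ⊥ B (A ⊔ B) bot_le le_sup_right

theorem relIndex_sup_sup_of_coprime [Finite G] {A B K L : Subgroup G} [K.Normal] [L.Normal]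
    (hAB : A ≤ B) (hKL : K ≤ L) (h : (Nat.card B).Coprime (Nat.card L)) :
    (A ⊔ K).relIndex (B ⊔ L) = A.relIndex B * K.relIndex L := by
  have hAK := (h.of_dvd (Subgroup.card_dvd_of_le hAB) (Subgroup.card_dvd_of_le hKL))
  have hcard {H J : Subgroup G} (hHJ : H ≤ J) : Nat.card H * H.relIndex J = Nat.card J := by
    simpa using Subgroup.relIndex_mul_relIndex ⊥ H J bot_le hHJ
  refine Nat.eq_of_mul_eq_mul_left (Nat.card_pos (α := ↥(A ⊔ K))) ?_
  rw [hcard (sup_le_sup hAB hKL), card_sup_of_coprime h, card_sup_of_coprime hAK, ← hcard hAB,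
    ← hcard hKL, mul_mul_mul_comm]

theorem relIndex_dvd_of_pow_mem {N : Subgroup G} [N.Normal] {x : G} {n : ℕ} (hx : x ^ n ∈ N)
    {U : Subgroup G} (hU : U ≤ N ⊔ Subgroup.zpowers x) : N.relIndex U ∣ n := by
  have hle : U.map (QuotientGroup.mk' N) ≤ Subgroup.zpowers (x : G ⧸ N) := by
    refine (Subgroup.map_mono hU).trans ?_
    rw [Subgroup.map_sup, QuotientGroup.map_mk'_self, bot_sup_eq, MonoidHom.map_zpowers]
    rfl
  have hrel := Subgroup.relIndex_ker (K := U) (QuotientGroup.mk' N)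
  rw [QuotientGroup.ker_mk'] at hrel
  rw [hrel]
  refine (Subgroup.card_dvd_of_le hle).trans ?_
  rw [Nat.card_zpowers]
  exact orderOf_dvd_of_pow_eq_one ((QuotientGroup.eq_one_iff _).2 hx)

theorem normal_subgroupOf_inf_centralizer_sup [Finite G] {D U K L : Subgroup G} [D.Normal]
    [K.Normal] (hLD : L ≤ D) :
    (((U ⊓ Subgroup.centralizer (D : Set G)) ⊔ K).subgroupOf (U ⊔ L)).Normal := by
  set Γ := Subgroup.centralizer (D : Set G)
  refine Subgroup.normal_subgroupOf_of_le_normalizer <| le_trans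
    (le_inf (sup_le ?_ ?_) Subgroup.le_normalizer_of_normal)
    (Subgroup.normalizer_inf_normalizer_le_normalizer_sup _ _)
  · exact (le_inf Subgroup.le_normalizer Subgroup.le_normalizer_of_normal).trans
      Subgroup.inf_normalizer_le_normalizer_inf
  · calc L ≤ Subgroup.centralizer (Γ : Set G) := hLD.trans (Subgroup.le_centralizer_iff.1 le_rfl)
      _ ≤ Subgroup.centralizer (U ⊓ Γ : Subgroup G) := Subgroup.centralizer_le inf_le_right
      _ ≤ _ := Subgroup.centralizer_le_normalizer _

theorem exists_mem_notMem_prime_pow_mem [Finite G] {K D : Subgroup G} (h : K < D) :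
    ∃ d ∈ D, ∃ r : ℕ, r.Prime ∧ d ∉ K ∧ d ^ r ∈ K := by
  by_contra! hD
  refine h.not_ge (le_of_forall_primePow_mem fun x hx q hq k hk ↦ ?_)
  by_contra hxK
  obtain ⟨m, hm, hmq⟩ := exists_pow_notMem_pow_mem hxK (hk ▸ K.one_mem)
  exact hD _ (pow_mem hx m) q hq hm hmq

theorem isSubmodularSubgroup_top : IsSubmodularSubgroup (⊤ : Subgroup G) :=
  ⟨0, fun _ ↦ ⊤, rfl, rfl, by simp⟩

theorem IsSubmodularSubgroup.of_le {A B : Subgroup G} (hB : IsSubmodularSubgroup B) (hAB : A ≤ B)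
    (h : IsModularSubgroup (A.subgroupOf B)) : IsSubmodularSubgroup A := by
  obtain ⟨n, C, rfl, hn, hC⟩ := hB
  refine ⟨n + 1, fun i ↦ Nat.casesOn i A C, rfl, hn, fun i hi ↦ ?_⟩
  cases i with
  | zero => exact ⟨hAB, h⟩
  | succ i => exact hC i (Nat.succ_lt_succ_iff.1 hi)

theorem isSubmodularSubgroup_of_isSubnormal {A : Subgroup G} (hA : A.IsSubnormal) :
    IsSubmodularSubgroup A := by
  induction hA with
  | top => exact isSubmodularSubgroup_top
  | step H K h_le _ hN ih => exact ih.of_le h_le (isModularSubgroup_of_normal hN)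

namespace IsZacherGroup

theorem isSubmodularSubgroup_sup [Finite G] (h : IsZacherGroup G) {p : ℕ} (hp : p.Prime)
    {U : Subgroup G} (hU : (Nat.card U).Coprime (Nat.card (nilpotentResidual G))) {x : G}
    (hx : x ^ p ∈ Subgroup.centralizer (nilpotentResidual G : Set G))
    (hUx : U ≤ Subgroup.centralizer (nilpotentResidual G : Set G) ⊔ Subgroup.zpowers x)
    {K : Subgroup G} (hK : K ≤ nilpotentResidual G) : IsSubmodularSubgroup (U ⊔ K) := by
  set D := nilpotentResidual G
  set Γ := Subgroup.centralizer (D : Set G)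
  induction K using WellFoundedGT.induction with
  | ind K ih =>
  rcases hK.eq_or_lt with rfl | hlt
  · obtain ⟨n, hn⟩ := exists_lowerCentralSeries_eq_nilpotentResidual G
    exact isSubmodularSubgroup_of_isSubnormal
      (isSubnormal_of_lowerCentralSeries_le (hn.le.trans le_sup_right))
  obtain ⟨d, hdD, r, hr, hdK, hdr⟩ := exists_mem_notMem_prime_pow_mem hlt
  set L := K ⊔ Subgroup.zpowers d
  have hLD : L ≤ D := sup_le hK (Subgroup.zpowers_le.2 hdD)
  have hKL : K < L := SetLike.lt_iff_le_and_exists.2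
    ⟨le_sup_left, d, Subgroup.mem_sup_right (Subgroup.mem_zpowers d), hdK⟩
  have := h.normal_of_le K hK
  have := h.normal_of_le L hLD
  have := normal_subgroupOf_inf_centralizer_sup (U := U) (K := K) hLD
  have hindex : ((U ⊓ Γ) ⊔ K).relIndex (U ⊔ L) ∣ p * r := by
    rw [relIndex_sup_sup_of_coprime inf_le_left hKL.le
      (hU.coprime_dvd_right (Subgroup.card_dvd_of_le hLD)), inf_comm, Subgroup.inf_relIndex_right]
    exact mul_dvd_mul (relIndex_dvd_of_pow_mem hx hUx) (relIndex_dvd_of_pow_mem hdr le_rfl)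
  exact (ih L hKL hLD).of_le (sup_le_sup_left hKL.le U)
    (isModularSubgroup_of_index_dvd_prime_mul_prime hp hr hindex
      (Subgroup.comap_mono (sup_le_sup_right inf_le_left K)))

end IsZacherGroup

theorem commutatorElement_conj_eq {g x y : G} {r s : ℤ} (hx : x * g * x⁻¹ = g ^ r)
    (hy : y * g * y⁻¹ = g ^ s) (hc : Commute ⁅x, y⁆ g) :
    ⁅x, g * y * g⁻¹⁆ = g ^ ((r - 1) * (1 - s)) * ⁅x, y⁆ := by
  have hgy : g * y * g⁻¹ = g ^ (1 - s) * y := by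
    rw [zpow_sub, zpow_one, ← hy]; group
  calc ⁅x, g * y * g⁻¹⁆ = (x * g * x⁻¹) ^ (1 - s) * (⁅x, y⁆ * g ^ (-(1 - s))) := by
        rw [hgy, conj_zpow, commutatorElement_def, commutatorElement_def]; group
    _ = g ^ ((r - 1) * (1 - s)) * ⁅x, y⁆ := by
        rw [hx, (hc.zpow_right _).eq, ← zpow_mul, ← mul_assoc, ← zpow_add]; ring_nf

theorem mem_of_conj_mem {W : Subgroup G} {g x y : G} {q k : ℕ} {r s : ℤ} (hq : q.Prime)
    (hg : g ^ q ^ k = 1) (hx : x * g * x⁻¹ = g ^ r) (hr : ¬ (q : ℤ) ∣ r - 1)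
    (hy : y * g * y⁻¹ = g ^ s) (hs : ¬ (q : ℤ) ∣ s - 1) (hc : Commute ⁅x, y⁆ g)
    (hxW : x ∈ W) (hcW : ⁅x, y⁆ ∈ W) (hyW : g * y * g⁻¹ ∈ W) : y ∈ W := by
  have hpow : g ^ ((r - 1) * (1 - s)) ∈ W := by
    rw [← W.mul_mem_cancel_right hcW, ← commutatorElement_conj_eq hx hy hc, commutatorElement_def]
    exact mul_mem (mul_mem (mul_mem hxW hyW) (inv_mem hxW)) (inv_mem hyW)
  have hrs : ¬ (q : ℤ) ∣ (r - 1) * (1 - s) := by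
    rw [(Nat.prime_iff_prime_int.1 hq).dvd_mul, dvd_sub_comm (b := 1)]
    exact not_or.2 ⟨hr, hs⟩
  have hgW : g ∈ W := Subgroup.zpowers_le.2 hpow (mem_zpowers_zpow_of_not_dvd hq hg hrs)
  rwa [W.mul_mem_cancel_right (inv_mem hgW), W.mul_mem_cancel_left hgW] at hyW

theorem mem_of_mem_sup_zpowers_pow {W : Subgroup G} [W.Normal] {y : G} {p k : ℕ} (hp : p.Prime)
    (hy : y ^ p ^ k = 1) (h : y ∈ W ⊔ Subgroup.zpowers (y ^ p)) : y ∈ W := by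
  obtain ⟨w, hw, _, ⟨j, rfl⟩, hwy⟩ := Subgroup.mem_sup_of_normal_left.1 h
  have hyW : y ^ (1 - p * j) ∈ W := by
    rwa [zpow_sub, zpow_one, zpow_mul, zpow_natCast, ← eq_mul_inv_of_mul_eq hwy]
  refine Subgroup.zpowers_le.2 hyW (mem_zpowers_zpow_of_not_dvd hp hy ?_)
  rw [dvd_sub_left (dvd_mul_right _ j)]
  exact (Nat.prime_iff_prime_int.1 hp).not_dvd_one

theorem zpowers_conj_inf_le {D U : Subgroup G} [hD : D.Normal] (hUD : Disjoint U D) {p : ℕ}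
    (hp : p.Prime) (hU : IsPGroup p U) {g y : G} (hg : g ∈ D) (hy : y ∈ U)
    (hyg : ¬ Commute y g) : Subgroup.zpowers (g * y * g⁻¹) ⊓ U ≤ Subgroup.zpowers (y ^ p) := by
  rintro _ ⟨⟨i, rfl⟩, hiU⟩
  have hi : (g * y * g⁻¹) ^ i = y ^ i := by
    rw [← mul_inv_eq_one]
    refine Subgroup.disjoint_def.1 hUD (mul_mem hiU (inv_mem (zpow_mem hy i))) ?_
    rw [conj_zpow]
    simpa [mul_assoc] using mul_mem hg (hD.conj_mem _ (inv_mem hg) (y ^ i))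
  have hcomm : Commute (y ^ i) g := (mul_inv_eq_iff_eq_mul.1 (conj_zpow.symm.trans hi)).symm
  have hpi : (p : ℤ) ∣ i := by
    by_contra hpi
    obtain ⟨k, hk⟩ := exists_pow_prime_pow_eq_one hU hy
    obtain ⟨j, hj⟩ := Subgroup.mem_zpowers_iff.1 (mem_zpowers_zpow_of_not_dvd hp hk hpi)
    exact hyg (hj ▸ hcomm.zpow_left j)
  obtain ⟨j, rfl⟩ := hpi
  exact Subgroup.mem_zpowers_iff.2 ⟨j, by
    simpa only [zpow_mul, zpow_natCast] using hi.symm⟩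

theorem exists_conj_eq_zpow_not_dvd {D U : Subgroup G} (hD : powerNormalizer D = ⊤)
    (hUD : (Nat.card U).Coprime (Nat.card D)) {g u : G} (hg : g ∈ D) {q k : ℕ} (hq : q.Prime)
    (hgq : g ^ q ^ k = 1) (hu : u ∈ U) (hug : ¬ Commute u g) :
    ∃ r : ℤ, u * g * u⁻¹ = g ^ r ∧ ¬ (q : ℤ) ∣ r - 1 := by
  obtain ⟨r, hr⟩ := Subgroup.mem_zpowers_iff.1
    (conj_mem_zpowers_of_mem_powerNormalizer (hD ▸ Subgroup.mem_top u) hg)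
  have hqD : q ∣ Nat.card D := by
    by_contra hqD
    have hg1 : g = 1 := eq_one_of_pow_eq_one_of_coprime hgq
      (orderOf_dvd_iff_pow_eq_one.1 (D.orderOf_dvd_natCard hg))
      ((hq.coprime_iff_not_dvd.2 hqD).pow_left k)
    exact hug (hg1 ▸ Commute.one_right u)
  have hcop : (orderOf u).Coprime q :=
    (hUD.coprime_dvd_left (U.orderOf_dvd_natCard hu)).coprime_dvd_right hqD
  exact ⟨r, hr.symm, not_dvd_sub_one_of_not_commute hcop hgq hr.symm hug⟩

theorem exists_primePow_not_commute [Finite G] {D : Subgroup G} {x : G}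
    (hx : x ∉ Subgroup.centralizer (D : Set G)) :
    ∃ g ∈ D, ∃ q : ℕ, q.Prime ∧ (∃ k, g ^ q ^ k = 1) ∧ ¬ Commute x g := by
  by_contra! h
  have hDx : D ≤ Subgroup.centralizer {x} := le_of_forall_primePow_mem fun g hg q hq k hk ↦
    Subgroup.mem_centralizer_singleton_iff.2 (h g hg q hq ⟨k, hk⟩).symm.eq
  exact hx (Subgroup.mem_centralizer_iff.2 fun d hd ↦
    Subgroup.mem_centralizer_singleton_iff.1 (hDx hd))

namespace IsModularSubgroup

variable {D U : Subgroup G} {x : G} {p : ℕ}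

theorem mem_centralizer_sup_zpowers (hD : powerNormalizer D = ⊤)
    (hUD : (Nat.card U).Coprime (Nat.card D)) (hp : p.Prime) (hU : IsPGroup p U) (hx : x ∈ U)
    (hV : IsModularSubgroup (U ⊓ Subgroup.centralizer (D : Set G) ⊔ Subgroup.zpowers x))
    {g y : G} (hg : g ∈ D) {q k : ℕ} (hq : q.Prime) (hgq : g ^ q ^ k = 1) (hxg : ¬ Commute x g)
    (hy : y ∈ U) (hyg : ¬ Commute y g) :
    y ∈ Subgroup.centralizer (D : Set G) ⊔ Subgroup.zpowers x := by
  set Γ := Subgroup.centralizer (D : Set G)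
  set V := U ⊓ Γ ⊔ Subgroup.zpowers x
  set Y := Subgroup.zpowers (g * y * g⁻¹)
  have hcΓ : commutator G ≤ Γ := commutator_le_centralizer_of_powerNormalizer_eq_top hD
  have : D.Normal := powerNormalizer_eq_top_iff.1 hD D le_rfl
  have : (Γ ⊔ Subgroup.zpowers x).Normal :=
    Subgroup.Normal.of_commutator_le G (hcΓ.trans le_sup_left)
  have hxy : ⁅x, y⁆ ∈ U ⊓ Γ :=
    ⟨U.mul_mem (U.mul_mem (U.mul_mem hx hy) (U.inv_mem hx)) (U.inv_mem hy),
      hcΓ (Subgroup.commutator_mem_commutator (Subgroup.mem_top x) (Subgroup.mem_top y))⟩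
  obtain ⟨r, hr, hqr⟩ := exists_conj_eq_zpow_not_dvd hD hUD hg hq hgq hx hxg
  obtain ⟨s, hs, hqs⟩ := exists_conj_eq_zpow_not_dvd hD hUD hg hq hgq hy hyg
  have hyVY : y ∈ V ⊔ Y := mem_of_conj_mem hq hgq hr hqr hs hqs
    (Subgroup.mem_centralizer_iff.1 hxy.2 g hg).symm
    (Subgroup.mem_sup_left (Subgroup.mem_sup_right (Subgroup.mem_zpowers x)))
    (Subgroup.mem_sup_left (Subgroup.mem_sup_left hxy))
    (Subgroup.mem_sup_right (Subgroup.mem_zpowers _))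
  have hVyU : V ⊔ Subgroup.zpowers y ≤ U :=
    sup_le (sup_le inf_le_left (Subgroup.zpowers_le.2 hx)) (Subgroup.zpowers_le.2 hy)
  have hymod : y ∈ V ⊔ (Y ⊓ (V ⊔ Subgroup.zpowers y)) := by
    rw [hV.2 Y _ le_sup_left]
    exact ⟨hyVY, Subgroup.mem_sup_right (Subgroup.mem_zpowers y)⟩
  obtain ⟨a, ha⟩ := exists_pow_prime_pow_eq_one hU hy
  have hYp : Y ⊓ (V ⊔ Subgroup.zpowers y) ≤ Subgroup.zpowers (y ^ p) :=
    (inf_le_inf_left Y hVyU).trans (zpowers_conj_inf_le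
      (Subgroup.disjoint_of_coprime_natCard hUD) hp hU hg hy hyg)
  exact mem_of_mem_sup_zpowers_pow hp ha
    (sup_le_sup (sup_le_sup_right inf_le_right (Subgroup.zpowers x)) hYp hymod)

theorem le_centralizer_sup_zpowers [Finite G] (hD : powerNormalizer D = ⊤)
    (hUD : (Nat.card U).Coprime (Nat.card D)) (hp : p.Prime) (hU : IsPGroup p U) (hx : x ∈ U)
    (hxD : x ∉ Subgroup.centralizer (D : Set G))
    (hV : IsModularSubgroup (U ⊓ Subgroup.centralizer (D : Set G) ⊔ Subgroup.zpowers x)) :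
    U ≤ Subgroup.centralizer (D : Set G) ⊔ Subgroup.zpowers x := by
  obtain ⟨g, hg, q, hq, ⟨k, hk⟩, hxg⟩ := exists_primePow_not_commute hxD
  intro y hy
  by_cases hyg : Commute y g
  · have hxyg : ¬ Commute (x * y) g := fun h ↦ hxg (by simpa using h.mul_left hyg.inv_left)
    exact (Subgroup.mul_mem_cancel_left _ (Subgroup.mem_sup_right (Subgroup.mem_zpowers x))).1
      (hV.mem_centralizer_sup_zpowers hD hUD hp hU hx hg hq hk hxg (mul_mem hx hy) hxyg)
  · exact hV.mem_centralizer_sup_zpowers hD hUD hp hU hx hg hq hk hxg hy hyg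

end IsModularSubgroup

theorem IsZacherGroup.isModularSubgroup_of_isPGroup [Finite G] (hG : IsZacherGroup G) {p : ℕ}
    (hp : p.Prime)
    (h : ∀ U : Subgroup G, IsPGroup p U → IsSubmodularSubgroup U → IsModularSubgroup U)
    {U : Subgroup G} (hU : IsPGroup p U) : IsModularSubgroup U := by
  set D := nilpotentResidual G
  set Γ := Subgroup.centralizer (D : Set G)
  have := Fact.mk hp
  have hD : powerNormalizer D = ⊤ := powerNormalizer_eq_top_iff.2 hG.normal_of_le
  by_cases hpD : p ∣ Nat.card D
  · refine isModularSubgroup_of_normal (hG.normal_of_le U fun u hu ↦ ?_)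
    obtain ⟨k, hk⟩ := exists_pow_prime_pow_eq_one hU hu
    exact mem_of_pow_eq_one_of_coprime_index hk
      ((hG.coprime_card_index.coprime_dvd_left hpD).pow_left k)
  have hcop {V : Subgroup G} (hV : IsPGroup p V) : (Nat.card V).Coprime (Nat.card D) := by
    obtain ⟨k, hk⟩ := hV.exists_card_eq
    exact hk ▸ (hp.coprime_iff_not_dvd.2 hpD).pow_left k
  have hmod {V : Subgroup G} (hVU : V ≤ U) {x : G} (hx : x ^ p ∈ Γ)
      (hVx : V ≤ Γ ⊔ Subgroup.zpowers x) : IsModularSubgroup V := by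
    have hV := hU.to_le hVU
    refine h V hV ?_
    simpa using hG.isSubmodularSubgroup_sup hp (hcop hV) hx hVx bot_le
  by_cases hUΓ : U ≤ Γ
  · exact hmod le_rfl (x := 1) (by simp [one_mem]) (hUΓ.trans le_sup_left)
  obtain ⟨u, hu, huΓ⟩ := SetLike.not_le_iff_exists.1 hUΓ
  obtain ⟨k, hk⟩ := exists_pow_prime_pow_eq_one hU hu
  obtain ⟨m, hmΓ, hmp⟩ := exists_pow_notMem_pow_mem huΓ (hk ▸ Γ.one_mem)
  have hV := hmod (sup_le inf_le_left (Subgroup.zpowers_le.2 (pow_mem hu m))) hmp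
    (sup_le_sup_right (inf_le_right (a := U)) _)
  exact hmod le_rfl hmp
    (hV.le_centralizer_sup_zpowers hD (hcop hU) hp hU (pow_mem hu m) hmΓ)

theorem isMGroup_of_forall_isPGroup_isModularSubgroup [Finite G]
    (h : ∀ p : ℕ, p.Prime → ∀ U : Subgroup G, IsPGroup p U → IsModularSubgroup U) :
    IsMGroup G := by
  have hmod (X : Subgroup G) : IsModularSubgroup X := by
    obtain ⟨M, hM⟩ := (Set.toFinite {M : Subgroup G | M ≤ X ∧ IsModularSubgroup M}).exists_maximal
      ⟨⊥, bot_le, isModularSubgroup_of_normal inferInstance⟩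
    have hXM : X ≤ M := le_of_forall_primePow_mem fun x hx q hq k hk ↦ by
      have hxq : IsPGroup q (Subgroup.zpowers x) := IsPGroup.of_card_dvd_pow (n := k) <| by
        rw [Nat.card_zpowers]
        exact orderOf_dvd_of_pow_eq_one hk
      exact hM.le_of_ge ⟨sup_le hM.prop.1 (Subgroup.zpowers_le.2 hx),
        hM.prop.2.sup (h q hq _ hxq)⟩ le_sup_left
        (Subgroup.mem_sup_right (Subgroup.mem_zpowers x))
    exact hXM.antisymm hM.prop.1 ▸ hM.prop.2
  exact ⟨fun {X} Y {Z} hXZ ↦ ((hmod Y).1 X Z hXZ).ge⟩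

end

theorem proposition4p13 (G : Type*) [Group G] [Finite G] [Group.IsSolvable G] (hPT : IsPTGroup G) :
    (∀ p : ℕ, p.Prime →
      (∀ U : Subgroup G, IsPGroup p U → IsSubmodularSubgroup U → IsModularSubgroup U) →
      ∀ U : Subgroup G, IsPGroup p U → IsModularSubgroup U) ∧
    ((∀ U : Subgroup G, IsSubmodularSubgroup U → IsModularSubgroup U) → IsMGroup G) :=
  ⟨fun _ hp h _ hU ↦ hPT.isZacherGroup.isModularSubgroup_of_isPGroup hp h hU,
    fun h ↦ isMGroup_of_forall_isPGroup_isModularSubgroup fun _ hp _ hU ↦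
      hPT.isZacherGroup.isModularSubgroup_of_isPGroup hp (fun V _ ↦ h V) hU⟩
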